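/- All vector spaces are over $\mathbb{R}$. A lcs is a Hausdorff locally convex topological vector space; for a lcs $E$ let $w=\sigma(E,E^{\ast})$ denote its weak topology. A topological space $Y$ is called Eberlein-Grothendieck if there is a homeomorphic embedding of $Y$ into $C_p(K)$ for some compact Hausdorff space $K$, where $C_p(K)$ is the space of continuous real-valued functions on $K$ with the topology of pointwise convergence. Then the following hold. (a) Let $E$ be a lcs such that $(E,w)$ is Eberlein-Grothendieck. If there is a continuous linear quotient mapping $\pi$ from $E$ onto a lcs $F$, then $(F,w)$ is also Eberlein-Grothendieck. (b) Let $E$ be a lcs such that $(E,w)$ is Eberlein-Grothendieck. Then $(F,w)$ is Eberlein-Grothendieck for every linear subspace $F\subset E$ (not necessarily closed, equipped with the subspace topology inherited from $E$). (c) Let $I$ be a countable set (for instance $I=\omega$) and let $(E_i)_{i\in I}$ be a family of lcs such that each $(E_i,w)$ is Eberlein-Grothendieck. Then the product $E=\prod_{i\in I}E_i$, with the product topology, also has the property that $(E,w)$ is Eberlein-Grothendieck. -/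

import Mathlib

universe u v

/-- `Cp X`: the set `C(X, ℝ)` of continuous real-valued functions on `X`, which is given the
topology of pointwise convergence below. -/
def Cp (X : Type u) [TopologicalSpace X] : Type u := C(X, ℝ)

namespace Cp

/-- The function on `X` underlying an element of `Cp X`. -/
def toFun {X : Type u} [TopologicalSpace X] (f : Cp X) : X → ℝ :=
  ContinuousMap.toFun (X := X) (Y := ℝ) f

/-- The topology of pointwise convergence, i.e. the one inherited from the product `X → ℝ`. -/
instance instTopologicalSpace (X : Type u) [TopologicalSpace X] : TopologicalSpace (Cp X) :=
  TopologicalSpace.induced (toFun : Cp X → X → ℝ) Pi.topologicalSpace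

theorem isEmbedding_toFun (X : Type u) [TopologicalSpace X] :
    Topology.IsEmbedding (toFun : Cp X → X → ℝ) :=
  ⟨⟨rfl⟩, fun _ _ h => ContinuousMap.ext (congrFun h)⟩

end Cp

/-- `Y` is an Eberlein-Grothendieck space: it embeds homeomorphically into `Cp K` for some compact
(Hausdorff) space `K`. Taking `K` in the universe of `Y` is no restriction, see
`IsEberleinGrothendieck.of_isEmbedding`. -/
def IsEberleinGrothendieck (Y : Type u) [TopologicalSpace Y] : Prop :=
  ∃ (K : Type u) (_ : TopologicalSpace K) (_ : CompactSpace K) (_ : T2Space K) (φ : Y → Cp K),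
    Topology.IsEmbedding φ

/-- The compact space may live in any universe. -/
theorem IsEberleinGrothendieck.of_isEmbedding {Y : Type u} [TopologicalSpace Y]
    {K : Type v} [TopologicalSpace K] [CompactSpace K] {φ : Y → Cp K}
    (hφ : Topology.IsEmbedding φ) : IsEberleinGrothendieck Y := by
  let e : K → Y → ℝ := fun k y => (φ y).toFun k
  have he : Continuous e :=
    continuous_pi fun y => ContinuousMap.continuous (X := K) (Y := ℝ) (φ y)
  let ψ : Y → Cp (Set.range e) := fun y =>
    (⟨fun k => k.1 y, (continuous_apply y).comp continuous_subtype_val⟩ : C(Set.range e, ℝ))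
  have h1 : Topology.IsEmbedding fun y k => (φ y).toFun k :=
    (Cp.isEmbedding_toFun K).comp hφ
  -- pulling back along the surjection `K → range e` turns `ψ` into `φ`
  have hr : Continuous fun (g : Set.range e → ℝ) (k : K) => g ⟨e k, k, rfl⟩ :=
    continuous_pi fun k => continuous_apply _
  have hψ : Continuous fun y => (ψ y).toFun := by
    refine continuous_pi ?_
    rintro ⟨_, k, rfl⟩
    exact (continuous_apply k).comp h1.continuous
  have h2 : Topology.IsEmbedding fun y => (ψ y).toFun :=
    Topology.IsEmbedding.of_comp hψ hr h1
  exact ⟨Set.range e, inferInstance, isCompact_iff_compactSpace.mp (isCompact_range he),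
    inferInstance, ψ, ((Cp.isEmbedding_toFun _).of_comp_iff).mp h2⟩

-- For a locally convex Hausdorff space E, (E,w) is Eberlein-Grothendieck exactly when countably
-- many weak-* compact sets span (equivalently, cover) E*. If (E,w) embeds in C_p(K), every
-- functional is bounded by 1 on a neighbourhood of 0 given by n points of K and a radius 1/(m+1);
-- for fixed (n,m) these functionals form a weak-* compact set, because K^n is compact
-- (`exists_isCompact_iUnion_weakDual`). Conversely, countably many compact sets of functionals are
-- scaled and glued into one compact space (`of_countable_family`). The dual condition is easy to
-- transport: for a quotient, F* is weak-* closed in E*; for a subspace, Hahn-Banach makes F* a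
-- continuous image of E*; the dual of a product is the direct sum of the duals.

universe w

section

open Topology Filter Set

/-! ### Compact families of functionals yield an embedding -/

/-- A space whose topology is determined by countably many compact families of functions is
Eberlein-Grothendieck. -/
theorem IsEberleinGrothendieck.of_countable_family {Y : Type u} [TopologicalSpace Y]
    {ι : Type v} [Countable ι] {K : ι → Type w} [∀ i, TopologicalSpace (K i)]
    [∀ i, CompactSpace (K i)] (f : ∀ i, K i → Y → ℝ)
    (hf : ∀ i y, Continuous fun k => f i k y)
    (hemb : IsEmbedding fun y (p : Σ i, K i) => f p.1 p.2 y) : IsEberleinGrothendieck Y := by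
  obtain ⟨enc, henc⟩ := exists_injective_nat ι
  -- Since |arctan| < 2, dividing by c makes the i-th family uniformly small for all but finitely
  -- many i, so the value 0 at infinity gives a continuous extension.
  let c : ι → ℝ := fun i => (enc i : ℝ) + 1
  have hc : ∀ i, 0 < c i := fun i => by positivity
  let g : Y → OnePoint (Σ i, K i) → ℝ := fun y p =>
    p.elim 0 fun q => Real.arctan (f q.1 q.2 y) / c q.1
  have hg : ∀ y, Continuous (g y) := by
    intro y
    refine (OnePoint.continuous_iff _).2 ⟨?_, ?_⟩
    · refine Metric.tendsto_nhds.2 fun ε hε => ?_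
      obtain ⟨N, hN⟩ := exists_nat_gt (2 / ε)
      have hfin : (enc ⁻¹' Set.Iio N).Finite := (Set.finite_Iio N).preimage henc.injOn
      have hcl : ∀ i, IsClosed (range (Sigma.mk i : K i → Σ i, K i)) :=
        fun i => IsClosedEmbedding.sigmaMk.isClosed_range
      have h1 : (⋃ i ∈ enc ⁻¹' Set.Iio N, range (Sigma.mk i : K i → Σ i, K i))ᶜ
          ∈ coclosedCompact (Σ i, K i) :=
        hasBasis_coclosedCompact.mem_of_mem ⟨hfin.isClosed_biUnion fun i _ => hcl i,
          hfin.isCompact_biUnion fun i _ => isCompact_range continuous_sigmaMk⟩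
      filter_upwards [h1] with p hp
      have hpN : N ≤ enc p.1 := by
        by_contra h
        exact hp (mem_biUnion (not_le.1 h) ⟨p.2, rfl⟩)
      have hpN' : (N : ℝ) ≤ enc p.1 := by exact_mod_cast hpN
      have h2 : |Real.arctan (f p.1 p.2 y)| < 2 := by
        have := Real.arctan_lt_pi_div_two (f p.1 p.2 y)
        have := Real.neg_pi_div_two_lt_arctan (f p.1 p.2 y)
        have := Real.pi_lt_four
        exact abs_lt.2 ⟨by linarith, by linarith⟩
      change dist (Real.arctan (f p.1 p.2 y) / c p.1) 0 < ε
      rw [Real.dist_0_eq_abs, abs_div, abs_of_pos (hc _), div_lt_iff₀ (hc _)]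
      have h3 : 2 < N * ε := (div_lt_iff₀ hε).1 hN
      have h4 : N * ε ≤ ε * c p.1 := by
        rw [mul_comm]
        exact mul_le_mul_of_nonneg_left (by simp only [c]; linarith) hε.le
      linarith
    · exact continuous_sigma fun i => (Real.continuous_arctan.comp (hf i y)).div_const (c i)
  let φ : Y → Cp (OnePoint (Σ i, K i)) := fun y => (⟨g y, hg y⟩ : C(_, ℝ))
  suffices h : IsEmbedding g from
    IsEberleinGrothendieck.of_isEmbedding (φ := φ) (((Cp.isEmbedding_toFun _).of_comp_iff).1 h)
  -- The scaling can be undone continuously, so g carries the same topology as f.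
  have hfg : ∀ (p : Σ i, K i) y, f p.1 p.2 y = Real.tan (g y (p : OnePoint _) * c p.1) := by
    intro p y
    change _ = Real.tan (Real.arctan (f p.1 p.2 y) / c p.1 * c p.1)
    rw [div_mul_cancel₀ _ (hc _).ne', Real.tan_arctan]
  have hmem : ∀ (p : Σ i, K i) y,
      g y (p : OnePoint _) * c p.1 ∈ Ioo (-(Real.pi / 2)) (Real.pi / 2) := by
    intro p y
    change Real.arctan (f p.1 p.2 y) / c p.1 * c p.1 ∈ _
    rw [div_mul_cancel₀ _ (hc _).ne']
    exact Real.arctan_mem_Ioo _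
  have hcf : ∀ p : Σ i, K i, Continuous (f p.1 p.2) := fun p =>
    (continuous_apply p).comp hemb.continuous
  refine ⟨⟨le_antisymm ?_ ?_⟩, fun y z hyz => hemb.injective ?_⟩
  · refine continuous_iff_le_induced.1 (continuous_pi fun p => ?_)
    induction p with
    | infty => exact continuous_const
    | coe p => exact (Real.continuous_arctan.comp (hcf p)).div_const _
  · rw [hemb.eq_induced]
    refine continuous_iff_le_induced.1 ?_
    let : TopologicalSpace Y := .induced g inferInstance
    refine continuous_pi fun p => ?_
    simp only [hfg]
    exact Real.continuousOn_tan_Ioo.comp_continuous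
      (((continuous_apply (p : OnePoint (Σ i, K i))).comp
        (continuous_induced_dom (f := g))).mul_const (c p.1)) (hmem p)
  · funext p
    simp only [hfg, hyz]

/-- If countably many weak-* compact sets span the dual of a Hausdorff locally convex space, then
its weak topology is Eberlein-Grothendieck. -/
theorem isEberleinGrothendieck_weakSpace_of_span_eq_top {F : Type u} [AddCommGroup F] [Module ℝ F]
    [TopologicalSpace F] [IsTopologicalAddGroup F] [ContinuousSMul ℝ F] [LocallyConvexSpace ℝ F]
    [T2Space F] {ι : Type v} [Countable ι] (C : ι → Set (WeakDual ℝ F))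
    (hC : ∀ i, IsCompact (C i)) (hspan : Submodule.span ℝ (⋃ i, C i) = ⊤) :
    IsEberleinGrothendieck (WeakSpace ℝ F) := by
  have : ∀ i, CompactSpace (C i) := fun i => isCompact_iff_compactSpace.1 (hC i)
  let ev : ∀ i, C i → WeakSpace ℝ F → ℝ := fun i a x => a.1 ((toWeakSpace ℝ F).symm x)
  refine IsEberleinGrothendieck.of_countable_family ev
    (fun i y => (WeakDual.eval_continuous _).comp continuous_subtype_val) ?_
  have hall : ∀ P : WeakDual ℝ F → Prop, (∀ i, ∀ a ∈ C i, P a) → P 0 →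
      (∀ a b, P a → P b → P (a + b)) → (∀ (r : ℝ) a, P a → P (r • a)) → ∀ a, P a := by
    intro P h1 h0 hadd hsmul a
    have ha : a ∈ Submodule.span ℝ (⋃ i, C i) := hspan ▸ Submodule.mem_top
    induction ha using Submodule.span_induction with
    | mem a ha => obtain ⟨i, hi⟩ := mem_iUnion.1 ha; exact h1 i a hi
    | zero => exact h0
    | add a b _ _ ha hb => exact hadd a b ha hb
    | smul r a _ ha => exact hsmul r a ha
  refine ⟨⟨le_antisymm ?_ ?_⟩, fun x y hxy => ?_⟩
  · refine continuous_iff_le_induced.1 (continuous_pi fun p => ?_)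
    exact WeakBilin.eval_continuous (topDualPairing ℝ F).flip p.2.1
  · refine continuous_iff_le_induced.1 ?_
    refine @continuous_pi _ _ _ (_) _ _ (hall _ ?_ ?_ ?_ ?_)
    · intro i a ha
      exact @Continuous.comp _ _ _ (_) _ _ _ (fun g => g ⟨i, a, ha⟩)
        (continuous_apply (A := fun _ => ℝ) (⟨i, a, ha⟩ : Σ i, C i))
        (continuous_induced_dom (f := fun x (p : Σ i, C i) => ev p.1 p.2 x))
    · exact @continuous_const _ _ (_) _ _
    · intro a b ha hb
      exact @Continuous.add _ _ _ _ _ (_) _ _ ha hb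
    · intro r a ha
      exact @Continuous.const_smul _ _ _ _ _ _ (_) _ ha r
  · refine (SeparatingDual.eq_iff_forall_dual_eq (R := ℝ) (V := F)).2 ?_
    refine hall (fun a => a x = a y) ?_ ?_ ?_ ?_
    · intro i a ha
      exact congrFun hxy (⟨i, a, ha⟩ : Σ i, C i)
    · rfl
    · intro a b ha hb
      exact congrArg₂ (· + ·) ha hb
    · intro r a ha
      exact congrArg (r • ·) ha

/-! ### An embedding yields weak-* σ-compactness of the dual -/

/-- The weak-* dual of a space whose weak topology is Eberlein-Grothendieck is `σ`-compact. -/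
theorem IsEberleinGrothendieck.exists_isCompact_iUnion_weakDual {E : Type u} [AddCommGroup E]
    [Module ℝ E] [TopologicalSpace E] [IsTopologicalAddGroup E] [ContinuousSMul ℝ E]
    (hE : IsEberleinGrothendieck (WeakSpace ℝ E)) :
    ∃ C : ℕ × ℕ → Set (WeakDual ℝ E), (∀ n, IsCompact (C n)) ∧ ⋃ n, C n = univ := by
  obtain ⟨K, _, _, _, φ, hφ⟩ := hE
  let f : K → E → ℝ := fun k x =>
    |(φ (toWeakSpace ℝ E x)).toFun k - (φ (toWeakSpace ℝ E 0)).toFun k|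
  have hfK : ∀ x, Continuous fun k => f k x := fun x =>
    ((ContinuousMap.continuous (X := K) (Y := ℝ) (φ (toWeakSpace ℝ E x))).sub
      (ContinuousMap.continuous (X := K) (Y := ℝ) (φ (toWeakSpace ℝ E 0)))).abs
  have hemb : IsEmbedding fun x : WeakSpace ℝ E => (φ x).toFun :=
    (Cp.isEmbedding_toFun K).comp hφ
  have hfE : ∀ k, Continuous (f k) := fun k =>
    ((((continuous_apply k).comp hemb.continuous).comp
      (toWeakSpaceCLM ℝ E).continuous).sub continuous_const).abs
  have hf0 : ∀ k, f k 0 = 0 := fun k => by simp [f]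
  -- The pair (k, g) says |g| ≤ 1 wherever all f (k i) < 1/(m+1). The disjunctive form makes this
  -- closed jointly in k and g, so projecting along the compact K^n keeps it closed.
  let T : ∀ n : ℕ × ℕ, Set ((Fin n.1 → K) × (E → ℝ)) := fun n =>
    {p | ∀ x, (∃ i, 1 / ((n.2 : ℝ) + 1) ≤ f (p.1 i) x) ∨ |p.2 x| ≤ 1}
  have hT : ∀ n, IsClosed (T n) := by
    intro n
    simp only [T, ofPred_forall]
    refine isClosed_iInter fun x => ?_
    simp only [ofPred_or, ofPred_exists]
    refine (isClosed_iUnion_of_finite fun i => ?_).union ?_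
    · exact isClosed_le continuous_const
        ((hfK x).comp ((continuous_apply i).comp continuous_fst))
    · exact isClosed_le ((continuous_apply x).comp continuous_snd).abs continuous_const
  let B : ∀ n : ℕ × ℕ, Set (E → ℝ) := fun n =>
    range ((↑) : (E →ₗ[ℝ] ℝ) → E → ℝ) ∩ Prod.snd '' T n
  have hB : ∀ n, IsCompact (B n) := by
    intro n
    have hcl : IsClosed (B n) := (LinearMap.isClosed_range_coe E ℝ (RingHom.id ℝ)).inter
      (isClosedMap_snd_of_compactSpace _ (hT n))
    -- For each k, x/(j+1) enters the neighbourhood given by k for some j, whence |g x| ≤ j+1.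
    -- Compactness of K^n leaves finitely many j; their sum bounds them all.
    have hbd : ∀ x, ∃ J : ℝ, ∀ g ∈ B n, |g x| ≤ J := by
      intro x
      let U : ℕ → Set (Fin n.1 → K) := fun j =>
        {k | ∀ i, f (k i) (((j : ℝ) + 1)⁻¹ • x) < 1 / ((n.2 : ℝ) + 1)}
      have hU : ∀ j, IsOpen (U j) := by
        intro j
        simp only [U, ofPred_forall]
        exact isOpen_iInter_of_finite fun i =>
          isOpen_lt ((hfK _).comp (continuous_apply i)) continuous_const
      have hcov : univ ⊆ ⋃ j, U j := by
        intro k _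
        have hlim : Tendsto (fun j : ℕ => ((j : ℝ) + 1)⁻¹ • x) atTop (𝓝 0) := by
          have := (tendsto_one_div_add_atTop_nhds_zero_nat (𝕜 := ℝ)).smul_const x
          simpa using this
        have : ∀ᶠ j : ℕ in atTop, ∀ i, f (k i) (((j : ℝ) + 1)⁻¹ • x) < 1 / ((n.2 : ℝ) + 1) := by
          refine eventually_all.2 fun i => ?_
          have h := ((hfE (k i)).tendsto 0).comp hlim
          rw [hf0] at h
          exact h.eventually_lt_const (by positivity)
        obtain ⟨j, hj⟩ := this.exists
        exact mem_iUnion.2 ⟨j, hj⟩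
      obtain ⟨t, ht⟩ := isCompact_univ.elim_finite_subcover U hU hcov
      refine ⟨∑ j ∈ t, ((j : ℝ) + 1), ?_⟩
      rintro g ⟨⟨g, rfl⟩, ⟨⟨k, g'⟩, hp, rfl : g' = g⟩⟩
      obtain ⟨j, hjt, hj⟩ := mem_iUnion₂.1 (ht (mem_univ k))
      have h1 : |g (((j : ℝ) + 1)⁻¹ • x)| ≤ 1 :=
        (hp (((j : ℝ) + 1)⁻¹ • x)).resolve_left fun ⟨i, hi⟩ => (hj i).not_ge hi
      have hpos : (0 : ℝ) < (j : ℝ) + 1 := by positivity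
      rw [map_smul, smul_eq_mul, abs_mul, abs_inv, abs_of_pos hpos, inv_mul_le_iff₀ hpos,
        mul_one] at h1
      exact h1.trans (Finset.single_le_sum (f := fun j : ℕ => (j : ℝ) + 1)
        (fun j _ => by positivity) hjt)
    choose J hJ using hbd
    refine (isCompact_univ_pi fun x => isCompact_Icc (a := -J x) (b := J x)).of_isClosed_subset
      hcl fun g hg x _ => abs_le.1 (hJ x g hg)
  have hcoe : IsEmbedding fun (a : WeakDual ℝ E) x => a x :=
    WeakBilin.isEmbedding (B := topDualPairing ℝ E) ContinuousLinearMap.coe_injective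
  refine ⟨fun n => (fun (a : WeakDual ℝ E) x => a x) ⁻¹' B n, fun n => ?_, ?_⟩
  · refine hcoe.isInducing.isCompact_preimage_iff ?_ |>.2 (hB n)
    -- Members of B n are only linear a priori; boundedness on a neighbourhood of 0 makes them
    -- continuous.
    rintro _ ⟨⟨g, rfl⟩, ⟨⟨k, g'⟩, hp, rfl : g' = g⟩⟩
    have hV : {x : E | ∀ i, f (k i) x < 1 / ((n.2 : ℝ) + 1)} ∈ 𝓝 (0 : E) := by
      refine eventually_all.2 fun i => ?_
      refine ((hfE (k i)).tendsto 0).eventually_lt_const ?_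
      rw [hf0]
      positivity
    have hb : Bornology.IsVonNBounded ℝ
        (g '' {x : E | ∀ i, f (k i) x < 1 / ((n.2 : ℝ) + 1)}) := by
      refine (NormedSpace.isVonNBounded_closedBall ℝ ℝ 1).subset ?_
      rintro _ ⟨x, hx, rfl⟩
      rw [mem_closedBall_zero_iff]
      exact (hp x).resolve_left fun ⟨i, hi⟩ => (hx i).not_ge hi
    exact ⟨g.clmOfExistsBoundedImage ⟨_, hV, hb⟩, rfl⟩
  · refine eq_univ_of_forall fun a => mem_iUnion.2 ?_
    have ha : Continuous fun x : WeakSpace ℝ E => a ((toWeakSpace ℝ E).symm x) :=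
      WeakBilin.eval_continuous (topDualPairing ℝ E).flip a
    have hnhds : {x : WeakSpace ℝ E | |a ((toWeakSpace ℝ E).symm x)| < 1}
        ∈ 𝓝 (toWeakSpace ℝ E 0) := by
      refine (ha.abs.tendsto _).eventually_lt_const ?_
      simp
    -- A basic neighbourhood of 0 inside {|a| < 1} involves finitely many points of K; m is chosen
    -- with 1/(m+1) below all its radii.
    rw [hemb.nhds_eq_comap, nhds_pi, ((hasBasis_pi fun k =>
      Metric.nhds_basis_ball).comap _).mem_iff] at hnhds
    obtain ⟨⟨I, ε⟩, ⟨hI, hε⟩, hsub⟩ := hnhds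
    have : ∀ᶠ m : ℕ in atTop, ∀ k ∈ I, 1 / ((m : ℝ) + 1) < ε k :=
      (eventually_all_finite hI).2 fun k hk =>
        (tendsto_one_div_add_atTop_nhds_zero_nat (𝕜 := ℝ)).eventually_lt_const (hε k hk)
    obtain ⟨m, hm⟩ := this.exists
    have := hI.fintype
    let e := Fintype.equivFin I
    refine ⟨(Fintype.card I, m), ⟨a.toLinearMap, rfl⟩,
      (fun i => (e.symm i : K), fun x => a x), fun x => ?_, rfl⟩
    by_contra! h
    refine h.2.not_ge (le_of_lt ?_)
    refine hsub (a := toWeakSpace ℝ E x) fun k hk => ?_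
    have h1 := h.1 (e ⟨k, hk⟩)
    simp only [Equiv.symm_apply_apply] at h1
    exact h1.trans (hm k hk)

/-! ### Duals of products and quotients -/

/-- A continuous linear functional on a product depends on finitely many coordinates. -/
theorem ContinuousLinearMap.exists_finset_sum_single {ι : Type v} [DecidableEq ι] {E : ι → Type u}
    [∀ i, AddCommGroup (E i)] [∀ i, Module ℝ (E i)] [∀ i, TopologicalSpace (E i)]
    (a : (∀ i, E i) →L[ℝ] ℝ) :
    ∃ s : Finset ι, ∀ x, a x = ∑ i ∈ s, a (Pi.single i (x i)) := by
  have h : {x | |a x| < 1} ∈ 𝓝 (0 : ∀ i, E i) :=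
    (a.continuous.abs.tendsto 0).eventually_lt_const (by simp)
  rw [nhds_pi, Filter.mem_pi] at h
  obtain ⟨I, hI, t, ht, hsub⟩ := h
  have hzero : ∀ x : ∀ i, E i, (∀ i ∈ I, x i = 0) → a x = 0 := by
    intro x hx
    by_contra hne
    -- Vectors vanishing on I stay in the neighbourhood under every scaling, but this one has
    -- a-value 1.
    have hmem : (a x)⁻¹ • x ∈ I.pi t := fun i hi => by
      simpa [hx i hi] using mem_of_mem_nhds (ht i)
    have h1 : |a ((a x)⁻¹ • x)| < 1 := hsub hmem
    rw [map_smul, smul_eq_mul, inv_mul_cancel₀ hne, abs_one] at h1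
    exact lt_irrefl _ h1
  refine ⟨hI.toFinset, fun x => ?_⟩
  rw [← map_sum, ← sub_eq_zero, ← map_sub]
  refine hzero _ fun i hi => ?_
  rw [Pi.sub_apply, Finset.sum_apply, Finset.sum_pi_single, if_pos (hI.mem_toFinset.2 hi), sub_self]

/-- The transpose of a continuous linear map, between the weak-* duals. -/
noncomputable def weakDualTranspose {E : Type u} {F : Type v} [AddCommGroup E] [Module ℝ E] [TopologicalSpace E]
    [AddCommGroup F] [Module ℝ F] [TopologicalSpace F] (π : E →L[ℝ] F) (a : WeakDual ℝ F) :
    WeakDual ℝ E :=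
  (WeakDual.toStrongDual a).comp π

theorem continuous_weakDualTranspose {E : Type u} {F : Type v} [AddCommGroup E] [Module ℝ E]
    [TopologicalSpace E] [AddCommGroup F] [Module ℝ F] [TopologicalSpace F] (π : E →L[ℝ] F) :
    Continuous (weakDualTranspose π) :=
  WeakDual.continuous_of_continuous_eval fun x => WeakDual.eval_continuous (π x)

/-- Each point of F is some π x, so evaluations on F are evaluations on E. The range is the
annihilator of ker π, hence closed: a functional killing ker π descends to F, continuously by the
quotient topology. -/
theorem isClosedEmbedding_weakDualTranspose {E : Type u} {F : Type v} [AddCommGroup E] [Module ℝ E]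
    [TopologicalSpace E] [AddCommGroup F] [Module ℝ F] [TopologicalSpace F] (π : E →L[ℝ] F)
    (hπ : IsQuotientMap π) : IsClosedEmbedding (weakDualTranspose π) := by
  have hcoe : IsEmbedding fun (a : WeakDual ℝ F) x => a x :=
    WeakBilin.isEmbedding (B := topDualPairing ℝ F) ContinuousLinearMap.coe_injective
  refine ⟨⟨⟨le_antisymm (continuous_weakDualTranspose π).le_induced ?_⟩, fun a b hab => ?_⟩, ?_⟩
  · rw [hcoe.eq_induced]
    refine continuous_iff_le_induced.1 (@continuous_pi _ _ _ (_) _ _ fun y => ?_)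
    obtain ⟨x, rfl⟩ := hπ.surjective y
    exact @Continuous.comp _ _ _ (_) _ _ _ (fun b : WeakDual ℝ E => b x)
      (WeakDual.eval_continuous x) (continuous_induced_dom (f := weakDualTranspose π))
  · refine ContinuousLinearMap.ext fun y => ?_
    obtain ⟨x, rfl⟩ := hπ.surjective y
    exact DFunLike.congr_fun (F := E →L[ℝ] ℝ) hab x
  · have hr : range (weakDualTranspose π) =
        ⋂ x : E, {a : WeakDual ℝ E | π x = 0 → a x = 0} := by
      ext a
      simp only [mem_iInter]
      constructor
      · rintro ⟨b, rfl⟩ x hx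
        change b (π x) = 0
        rw [hx, map_zero]
      · intro h
        have hfac : ∀ x y, π x = π y → a x = a y := by
          intro x y hxy
          have := h (x - y) (by rw [map_sub, hxy, sub_self])
          rwa [map_sub, sub_eq_zero] at this
        let σ := Function.surjInv hπ.surjective
        have hσ : ∀ y, π (σ y) = y := Function.surjInv_eq hπ.surjective
        have hcomp : ∀ x, a (σ (π x)) = a x := fun x => hfac _ _ (hσ _)
        let b : F →L[ℝ] ℝ :=
          { toFun := fun y => a (σ y)
            map_add' := fun y z => by
              rw [← map_add]
              exact hfac _ _ (by simp only [map_add, hσ])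
            map_smul' := fun r y => by
              rw [RingHom.id_apply, ← map_smul]
              exact hfac _ _ (by simp only [map_smul, hσ])
            cont := hπ.continuous_iff.2
              ((WeakDual.toStrongDual a).continuous.congr fun x => (hcomp x).symm) }
        exact ⟨b, ContinuousLinearMap.ext hcomp⟩
    rw [hr]
    refine isClosed_iInter fun x => ?_
    by_cases hx : π x = 0
    · simpa only [hx, true_imp_iff] using
        isClosed_eq (WeakDual.eval_continuous (𝕜 := ℝ) x) continuous_const
    · simp [hx]

/-! ### Quotients, subspaces and countable products -/

/-- The weak topology of a quotient of a locally convex space with Eberlein-Grothendieck weak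
topology is Eberlein-Grothendieck. -/
theorem IsEberleinGrothendieck.weakSpace_of_isQuotientMap {E : Type u} [AddCommGroup E] [Module ℝ E]
    [TopologicalSpace E] [IsTopologicalAddGroup E] [ContinuousSMul ℝ E]
    {F : Type v} [AddCommGroup F] [Module ℝ F] [TopologicalSpace F]
    [IsTopologicalAddGroup F] [ContinuousSMul ℝ F] [LocallyConvexSpace ℝ F] [T2Space F]
    (hE : IsEberleinGrothendieck (WeakSpace ℝ E)) (π : E →L[ℝ] F) (hπ : IsQuotientMap π) :
    IsEberleinGrothendieck (WeakSpace ℝ F) := by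
  obtain ⟨C, hC, hcov⟩ := hE.exists_isCompact_iUnion_weakDual
  refine isEberleinGrothendieck_weakSpace_of_span_eq_top (fun n => weakDualTranspose π ⁻¹' C n)
    (fun n => (isClosedEmbedding_weakDualTranspose π hπ).isCompact_preimage (hC n)) ?_
  rw [← preimage_iUnion, hcov, preimage_univ, Submodule.span_univ]

/-- The weak topology of a subspace of a locally convex space with Eberlein-Grothendieck weak
topology is Eberlein-Grothendieck. -/
theorem IsEberleinGrothendieck.weakSpace_submodule {E : Type u} [AddCommGroup E] [Module ℝ E]
    [TopologicalSpace E] [IsTopologicalAddGroup E] [ContinuousSMul ℝ E] [LocallyConvexSpace ℝ E]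
    [T2Space E] (hE : IsEberleinGrothendieck (WeakSpace ℝ E)) (F : Submodule ℝ E) :
    IsEberleinGrothendieck (WeakSpace ℝ F) := by
  obtain ⟨C, hC, hcov⟩ := hE.exists_isCompact_iUnion_weakDual
  have : LocallyConvexSpace ℝ F := .induced F.subtype
  refine isEberleinGrothendieck_weakSpace_of_span_eq_top
    (fun n => weakDualTranspose F.subtypeL '' C n)
    (fun n => (hC n).image (continuous_weakDualTranspose _)) ?_
  have hsurj : Function.Surjective (weakDualTranspose F.subtypeL) := fun a => by
    obtain ⟨g, hg⟩ := StrongDual.exists_extension F (WeakDual.toStrongDual a)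
    exact ⟨g, ContinuousLinearMap.ext hg⟩
  rw [← image_iUnion, hcov, image_univ, hsurj.range_eq, Submodule.span_univ]

/-- The weak topology of a countable product of locally convex spaces with Eberlein-Grothendieck
weak topologies is Eberlein-Grothendieck. -/
theorem isEberleinGrothendieck_weakSpace_pi {ι : Type v} [Countable ι] {E : ι → Type u}
    [∀ i, AddCommGroup (E i)] [∀ i, Module ℝ (E i)] [∀ i, TopologicalSpace (E i)]
    [∀ i, IsTopologicalAddGroup (E i)] [∀ i, ContinuousSMul ℝ (E i)]
    [∀ i, LocallyConvexSpace ℝ (E i)] [∀ i, T2Space (E i)]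
    (hE : ∀ i, IsEberleinGrothendieck (WeakSpace ℝ (E i))) :
    IsEberleinGrothendieck (WeakSpace ℝ (∀ i, E i)) := by
  classical
  choose C hC hcov using fun i => (hE i).exists_isCompact_iUnion_weakDual
  refine isEberleinGrothendieck_weakSpace_of_span_eq_top
    (fun p : ι × (ℕ × ℕ) => weakDualTranspose (ContinuousLinearMap.proj p.1) '' C p.1 p.2)
    (fun p => (hC p.1 p.2).image (continuous_weakDualTranspose _)) ?_
  refine Submodule.eq_top_iff'.2 fun a => ?_
  obtain ⟨s, hs⟩ := ContinuousLinearMap.exists_finset_sum_single (WeakDual.toStrongDual a)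
  -- b i is the restriction of a to the i-th factor, so a is a finite sum of pulled-back b i.
  let b : ∀ i, WeakDual ℝ (E i) := fun i => weakDualTranspose (ContinuousLinearMap.single ℝ E i) a
  have hab : a = ∑ i ∈ s, weakDualTranspose (ContinuousLinearMap.proj i) (b i) :=
    ContinuousLinearMap.ext fun x =>
      (hs x).trans (sum_apply (F := (∀ i, E i) →L[ℝ] ℝ) s
        (fun i => weakDualTranspose (ContinuousLinearMap.proj i) (b i)) x).symm
  rw [hab]
  refine Submodule.sum_mem _ fun i _ => Submodule.subset_span ?_
  obtain ⟨n, hn⟩ := mem_iUnion.1 ((hcov i).symm ▸ mem_univ (b i) : b i ∈ ⋃ n, C i n)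
  exact mem_iUnion.2 ⟨(i, n), mem_image_of_mem _ hn⟩

end

theorem mainTheorem11 :
    -- (a) continuous linear quotients
    (∀ (E : Type u) [AddCommGroup E] [Module ℝ E] [TopologicalSpace E]
        [IsTopologicalAddGroup E] [ContinuousSMul ℝ E] [LocallyConvexSpace ℝ E] [T2Space E]
        (F : Type v) [AddCommGroup F] [Module ℝ F] [TopologicalSpace F]
        [IsTopologicalAddGroup F] [ContinuousSMul ℝ F] [LocallyConvexSpace ℝ F] [T2Space F]
        (π : E →L[ℝ] F), Topology.IsQuotientMap π →
        IsEberleinGrothendieck (WeakSpace ℝ E) → IsEberleinGrothendieck (WeakSpace ℝ F)) ∧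
    -- (b) linear subspaces, not necessarily closed
    (∀ (E : Type u) [AddCommGroup E] [Module ℝ E] [TopologicalSpace E]
        [IsTopologicalAddGroup E] [ContinuousSMul ℝ E] [LocallyConvexSpace ℝ E] [T2Space E],
        IsEberleinGrothendieck (WeakSpace ℝ E) →
        ∀ F : Submodule ℝ E, IsEberleinGrothendieck (WeakSpace ℝ F)) ∧
    -- (c) countable products
    (∀ (ι : Type v) [Countable ι] (E : ι → Type u)
        [∀ i, AddCommGroup (E i)] [∀ i, Module ℝ (E i)] [∀ i, TopologicalSpace (E i)]
        [∀ i, IsTopologicalAddGroup (E i)] [∀ i, ContinuousSMul ℝ (E i)]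
        [∀ i, LocallyConvexSpace ℝ (E i)] [∀ i, T2Space (E i)],
        (∀ i, IsEberleinGrothendieck (WeakSpace ℝ (E i))) →
        IsEberleinGrothendieck (WeakSpace ℝ (∀ i, E i))) := by
  refine ⟨?_, ?_, ?_⟩
  · intro E _ _ _ _ _ _ _ F _ _ _ _ _ _ _ π hπ hE
    exact hE.weakSpace_of_isQuotientMap π hπ
  · intro E _ _ _ _ _ _ _ hE F
    exact hE.weakSpace_submodule F
  · intro ι _ E _ _ _ _ _ _ _ hE
    exact isEberleinGrothendieck_weakSpace_pi hE
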